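/- Let $E$ be a separable real Banach space with norm $|\cdot|$, and let $\mathrm{UC}_b$ be the set of bounded uniformly continuous functions $E\to\mathbb R$. Let $c\colon E\to[0,\infty]$ be convex with $c(0)=0$ and $c(a)/|a|\to\infty$ as $|a|\to\infty$, and put $$\overline c(b):=\sup_{a\in E}\big(b|a|-c(a)\big),\qquad b\in[0,\infty).$$ Let $(Y_t)_{t\ge0}$ be an $E$-valued Lévy process on a filtered probability space $(\Omega,\mathcal F,(\mathcal F_t)_{t\ge0},\mathbb P)$: it is adapted, $Y_0=0$ almost surely, $Y_t-Y_s$ is independent of $\mathcal F_s$ for $s\le t$, the increments are stationary, and $Y$ is continuous in probability. No completeness or right-continuity of the filtration is assumed. Let $\mu_t$ be the law of $Y_t$ for $t>0$. For $f\in\mathrm{UC}_b$, $t>0$ and $x\in E$ define $$(\Phi_tf)(x):=\sup_{a\in E}\big(f(x+a)-t\,c(a/t)\big),\qquad (\mu_tf)(x):=\int_Ef(x+y)\,\mu_t(dy),$$ $$I_tf:=\mu_t\Phi_tf,\qquad J_tf:=\Phi_t\mu_tf,$$ and $I_0f:=J_0f:=f$. Let $\mathcal A$ be the set of all (jointly measurable)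 adapted processes $\alpha\colon[0,\infty)\times\Omega\to E$ with $\int_0^t|\alpha_u|\,du<\infty$ almost surely for all $t\ge0$, and define $$(V_tf)(x):=\sup_{\alpha\in\mathcal A}\mathbb E\Big[f\Big(x+Y_t+\int_0^t\alpha_u\,du\Big)-\int_0^tc(\alpha_u)\,du\Big].$$ For $f\in\mathrm{UC}_b$ and $\varepsilon>0$ put $\operatorname{var}f:=\sup_{x,y\in E}|f(x)-f(y)|$ and $$\omega_f^{-1}(\varepsilon):=\sup\{\delta>0:\ |f(x)-f(y)|\le\varepsilon\text{ for all }x,y\in E\text{ with }|x-y|\le\delta\}\in(0,\infty],$$ where $\operatorname{var}f/\infty:=0$, and put $\|f\|_{\mathrm{Lip}}:=\sup_{x,y\in E}\frac{|f(x)-f(y)|}{|x-y|}$ with $\frac00:=0$. Let $\|\cdot\|_\infty$ be the supremum norm. Then, for every $t\ge0$ and $f\in\mathrm{UC}_b$, the following holds, where $n$ ranges over $\{1,2,\dots\}$ and inequalities, suprema and infima of functions are pointwise on $E$. (a) For all $n$, $$J_{t/n}^nf\le V_tf\le I_{t/n}^nf,$$ and, for all $\varepsilon>0$, $$\big\|I_{t/n}^nf-J_{t/n}^nf\big\|_\infty\le\varepsilon\quad\text{if}\quad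 n\ge\frac t\varepsilon\,\overline c\Big(\frac{\operatorname{var}f}{\omega_f^{-1}(\varepsilon)}\Big).$$ Moreover, $$\sup_{n}J_{t/n}^nf=V_tf=\inf_{n}I_{t/n}^nf.$$ (b) If $\|f\|_{\mathrm{Lip}}<\infty$, then, for all $n$, $$\big\|I_{t/n}^nf-J_{t/n}^nf\big\|_\infty\le\frac tn\,\overline c\big(\|f\|_{\mathrm{Lip}}\big).$$ -/

import Mathlib

open MeasureTheory ProbabilityTheory Filter Topology
open scoped NNReal ENNReal

namespace LevyControl

noncomputable section

/-- Bounded and uniformly continuous real-valued functions on `E`. -/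
def IsUCb {E : Type*} [NormedAddCommGroup E] (f : E → ℝ) : Prop :=
  UniformContinuous f ∧ ∃ C : ℝ, ∀ x, |f x| ≤ C

/-- The oscillation `var f = sup_{x, y} |f x - f y|`. -/
def oscillation {E : Type*} [NormedAddCommGroup E] (f : E → ℝ) : ℝ≥0∞ :=
  ⨆ (x : E) (y : E), ‖f x - f y‖ₑ

/-- The inverse modulus of continuity `ω_f⁻¹(ε)`, a value in `[0, ∞]`. -/
def invModulus {E : Type*} [NormedAddCommGroup E] (f : E → ℝ) (ε : ℝ) : ℝ≥0∞ :=
  sSup {d : ℝ≥0∞ | ∃ δ : ℝ, 0 < δ ∧ (∀ x y : E, ‖x - y‖ ≤ δ → |f x - f y| ≤ ε) ∧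
    d = ENNReal.ofReal δ}

/-- The Lipschitz seminorm `sup_{x, y} |f x - f y| / ‖x - y‖` with `0 / 0 = 0`,
a value in `[0, ∞]`. -/
def lipSeminorm {E : Type*} [NormedAddCommGroup E] (f : E → ℝ) : ℝ≥0∞ :=
  ⨆ (x : E) (y : E), ‖f x - f y‖ₑ / ‖x - y‖ₑ

/-- A running cost: a convex function `c : E → [0, ∞]` with `c 0 = 0` and
`c a / ‖a‖ → ∞` as `‖a‖ → ∞`. -/
structure IsCost {E : Type*} [NormedAddCommGroup E] [NormedSpace ℝ E] (c : E → ℝ≥0∞) :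
    Prop where
  convex : ConvexOn ℝ≥0 Set.univ c
  zero : c 0 = 0
  superlinear : Tendsto (fun a => c a / ‖a‖ₑ) (Bornology.cobounded E) (𝓝 ⊤)

/-- The function `c̄(b) = sup_a (b ‖a‖ - c a)`. -/
def conj {E : Type*} [NormedAddCommGroup E] (c : E → ℝ≥0∞) (b : ℝ) : EReal :=
  ⨆ a : E, (((b * ‖a‖ : ℝ) : EReal) - (c a : EReal))

/-- The Hopf-Lax operator `(Φ_t f)(x) = sup_a (f (x + a) - t c(a / t))` for `t > 0`, and
`Φ_0 f = f`. For bounded `f` and `c 0 = 0` the supremum is finite, so that `toReal` only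
changes its type. -/
def hopfLax {E : Type*} [NormedAddCommGroup E] [NormedSpace ℝ E] (c : E → ℝ≥0∞) (t : ℝ≥0)
    (f : E → ℝ) (x : E) : ℝ :=
  if t = 0 then f x
  else (⨆ a : E, ((f (x + a) : EReal) - (((t : ℝ≥0∞) * c (t⁻¹ • a) : ℝ≥0∞) : EReal))).toReal

/-- `(μ f)(x) = ∫ f (x + y) μ(dy)`. -/
def transition {E : Type*} [NormedAddCommGroup E] [MeasurableSpace E] (μ : Measure E)
    (f : E → ℝ) (x : E) : ℝ :=
  ∫ y, f (x + y) ∂μ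

/-- `I_t f = μ_t Φ_t f` for `t > 0`, and `I_0 f = f`. -/
def opI {E : Type*} [NormedAddCommGroup E] [NormedSpace ℝ E] [MeasurableSpace E]
    (c : E → ℝ≥0∞) (μ : ℝ≥0 → Measure E) (t : ℝ≥0) (f : E → ℝ) : E → ℝ :=
  if t = 0 then f else transition (μ t) (hopfLax c t f)

/-- `J_t f = Φ_t μ_t f` for `t > 0`, and `J_0 f = f`. -/
def opJ {E : Type*} [NormedAddCommGroup E] [NormedSpace ℝ E] [MeasurableSpace E]
    (c : E → ℝ≥0∞) (μ : ℝ≥0 → Measure E) (t : ℝ≥0) (f : E → ℝ) : E → ℝ :=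
  if t = 0 then f else hopfLax c t (transition (μ t) f)

/-- Lévy processes with respect to a filtration: adapted, started at `0`, with increments that
are stationary and independent of the past, and continuous in probability. -/
structure IsLevyProcess {E Ω : Type*} [NormedAddCommGroup E] [MeasurableSpace E]
    [BorelSpace E] {mΩ : MeasurableSpace Ω} (P : Measure Ω) (ℱ : Filtration ℝ≥0 mΩ)
    (Y : ℝ≥0 → Ω → E) : Prop where
  adapted : Adapted ℱ Y
  zero : ∀ᵐ ω ∂P, Y 0 ω = 0
  indep : ∀ s t : ℝ≥0, s ≤ t →
    Indep (MeasurableSpace.comap (fun ω => Y t ω - Y s ω) inferInstance) (ℱ s) P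
  stationary : ∀ s t : ℝ≥0, IdentDistrib (fun ω => Y (s + t) ω - Y s ω) (Y t) P P
  continuous_in_probability : ∀ t : ℝ≥0, TendstoInMeasure P Y (𝓝 t) (Y t)

/-- Admissible controls: (jointly measurable) adapted processes `α : [0, ∞) × Ω → E` such that
`∫_0^t ‖α_u‖ du < ∞` almost surely for all `t ≥ 0`. -/
structure IsControl {E Ω : Type*} [NormedAddCommGroup E] [MeasurableSpace E]
    {mΩ : MeasurableSpace Ω} (P : Measure Ω) (ℱ : Filtration ℝ≥0 mΩ)
    (α : ℝ≥0 → Ω → E) : Prop where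
  measurable : Measurable (Function.uncurry α)
  adapted : Adapted ℱ α
  integrable : ∀ᵐ ω ∂P, ∀ t : ℝ≥0, ∫⁻ u in Set.Ioc (0 : ℝ) t, ‖α u.toNNReal ω‖ₑ < ⊤

/-- The controlled state `x + Y_t + ∫_0^t α_u du`. -/
def controlled {E Ω : Type*} [NormedAddCommGroup E] [NormedSpace ℝ E]
    (Y α : ℝ≥0 → Ω → E) (x : E) (t : ℝ≥0) (ω : Ω) : E :=
  x + Y t ω + ∫ u in Set.Ioc (0 : ℝ) t, α u.toNNReal ω

/-- The running cost `∫_0^t c(α_u) du`. -/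
def runningCost {E Ω : Type*} (c : E → ℝ≥0∞) (α : ℝ≥0 → Ω → E) (t : ℝ≥0) (ω : Ω) : ℝ≥0∞ :=
  ∫⁻ u in Set.Ioc (0 : ℝ) t, c (α u.toNNReal ω)

/-- The value function
`(V_t f)(x) = sup_α E[f (x + Y_t + ∫_0^t α_u du) - ∫_0^t c(α_u) du]`, where the supremum is over
the admissible controls. As `f` is bounded and `c` is nonnegative, the expectation of the
difference is the difference of the expectations, with a value in `[-∞, ∞)`. -/
def value {E Ω : Type*} [NormedAddCommGroup E] [NormedSpace ℝ E] [MeasurableSpace E]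
    {mΩ : MeasurableSpace Ω} (P : Measure Ω) (ℱ : Filtration ℝ≥0 mΩ) (Y : ℝ≥0 → Ω → E)
    (c : E → ℝ≥0∞) (t : ℝ≥0) (f : E → ℝ) (x : E) : EReal :=
  ⨆ (α : ℝ≥0 → Ω → E) (_ : IsControl P ℱ α),
    (((∫ ω, f (controlled Y α x t ω) ∂P : ℝ) : EReal) -
      ((∫⁻ ω, runningCost c α t ω ∂P : ℝ≥0∞) : EReal))

end

end LevyControl

/-! Put h = t/n with t > 0. On each interval of length h, `opI` lets the controller see the noise
increment before choosing a displacement, while `opJ` demands a constant velocity chosen in advance.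
True controls lie between the two.

Upper bound: Jensen's inequality, applied path by path, bounds the gain on an interval by a Hopf-Lax
step started after the increment; independence then averages the increment out
(`IsControl.integral_controlled_step`). Since c need not be measurable, Jensen is proved for its
lower semicontinuous envelope (`IsCost.le_hopfLax_add_lintegral`). The state must be measurable with
respect to the past, up to null sets, although controls are only adapted and jointly measurable
(`aestronglyMeasurable_integral`).

Lower bound: nearly optimal Hopf-Lax displacements, selected measurably with countably many values,
give controls that are constant in time on each interval (`IsControl.exists_extension`).

Gap: (μΦ)^n = μ(Φμ)^(n-1)Φ. As J is monotone, commutes with constants, and Φ ≥ id, the errors do not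
accumulate: I^n f - J^n f is at most sup (Φ_h f - f) (`iterate_opI_le_iterate_opJ_add`). This single
step is estimated by c̄ and the modulus of f (`hopfLax_le_add_max`). -/

namespace LevyControl

/-! ### Hopf-Lax and transition operators on bounded uniformly continuous functions -/

section Operators

theorem coe_sub_coe_ennreal (r : ℝ) {C : ℝ≥0∞} (hC : C ≠ ⊤) :
    (r : EReal) - (C : EReal) = ((r - C.toReal : ℝ) : EReal) := by
  lift C to ℝ≥0 using hC
  rfl

variable {E : Type*} [NormedAddCommGroup E]

theorem IsUCb.continuous {f : E → ℝ} (hf : IsUCb f) : Continuous f := hf.1.continuous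

/-- Φ and μ are built from translates of f, so each inherits every one-sided modulus of f;
exchanging x and y makes the modulus two-sided. -/
theorem isUCb_of_modulus {f g : E → ℝ} (hf : IsUCb f)
    (hg : ∃ C : ℝ, ∀ x, |g x| ≤ C)
    (h : ∀ δ ε : ℝ, (∀ x y, dist x y < δ → f x ≤ f y + ε) →
      ∀ x y, dist x y < δ → g x ≤ g y + ε) : IsUCb g := by
  refine ⟨?_, hg⟩
  rw [Metric.uniformContinuous_iff]
  intro ε hε
  obtain ⟨δ, hδ, H⟩ := Metric.uniformContinuous_iff.1 hf.1 (ε / 2) (half_pos hε)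
  have H' := h δ (ε / 2) (fun x y hxy => by
    have := (abs_lt.1 (by simpa [Real.dist_eq] using H hxy)).2
    linarith)
  refine ⟨δ, hδ, fun x y hxy => ?_⟩
  have h1 := H' x y hxy
  have h2 := H' y x (by rwa [dist_comm])
  rw [Real.dist_eq, abs_lt]
  constructor <;> linarith

section HopfLax

variable [NormedSpace ℝ E] {c : E → ℝ≥0∞} {t : ℝ≥0} {f g : E → ℝ}

theorem hopfLax_zero : hopfLax c 0 f = f := by
  funext x; simp [hopfLax]

theorem coe_hopfLax (ht : t ≠ 0) (h0 : c 0 = 0) (hf : ∃ C : ℝ, ∀ x, |f x| ≤ C) (x : E) :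
    (hopfLax c t f x : EReal) =
      ⨆ a : E, ((f (x + a) : EReal) - (((t : ℝ≥0∞) * c (t⁻¹ • a) : ℝ≥0∞) : EReal)) := by
  obtain ⟨C, hC⟩ := hf
  rw [hopfLax, if_neg ht, EReal.coe_toReal]
  · refine ne_top_of_le_ne_top (EReal.coe_ne_top C) (iSup_le fun a => ?_)
    refine (EReal.sub_le_of_le_add' ?_)
    calc (f (x + a) : EReal) ≤ (C : EReal) := by exact_mod_cast (abs_le.1 (hC _)).2
      _ ≤ _ := le_add_of_nonneg_left (EReal.coe_ennreal_nonneg _)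
  · refine ne_bot_of_le_ne_bot (EReal.coe_ne_bot (f x)) (le_iSup_of_le 0 ?_)
    simp [h0]

theorem coe_sub_mul_toReal (r : ℝ) {C : ℝ≥0∞} (hC : C ≠ ⊤) :
    ((r - t * C.toReal : ℝ) : EReal) = (r : EReal) - (((t : ℝ≥0∞) * C : ℝ≥0∞) : EReal) := by
  rw [coe_sub_coe_ennreal _ (ENNReal.mul_ne_top ENNReal.coe_ne_top hC), ENNReal.toReal_mul]
  rfl

theorem le_hopfLax (ht : t ≠ 0) (h0 : c 0 = 0) (hf : ∃ C : ℝ, ∀ x, |f x| ≤ C) (x b : E)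
    (hb : c b ≠ ⊤) : f (x + t • b) - t * (c b).toReal ≤ hopfLax c t f x := by
  rw [← EReal.coe_le_coe_iff, coe_hopfLax ht h0 hf, coe_sub_mul_toReal _ hb]
  refine le_iSup_of_le (t • b) ?_
  rw [inv_smul_smul₀ ht]

theorem hopfLax_le (ht : t ≠ 0) (h0 : c 0 = 0) (hf : ∃ C : ℝ, ∀ x, |f x| ≤ C) {x : E} {r : ℝ}
    (h : ∀ b, c b ≠ ⊤ → f (x + t • b) - t * (c b).toReal ≤ r) : hopfLax c t f x ≤ r := by
  rw [← EReal.coe_le_coe_iff, coe_hopfLax ht h0 hf]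
  refine iSup_le fun a => ?_
  by_cases hb : c (t⁻¹ • a) = ⊤
  -- As t ≠ 0, an infinite cost makes the term -∞, so only displacements of finite cost count.
  · rw [hb, ENNReal.mul_top (by simpa using ht), EReal.coe_ennreal_top]
    simp
  · rw [← coe_sub_mul_toReal _ hb, EReal.coe_le_coe_iff]
    simpa [smul_inv_smul₀ ht] using h _ hb

theorem exists_lt_of_lt_hopfLax (ht : t ≠ 0) (h0 : c 0 = 0) (hf : ∃ C : ℝ, ∀ x, |f x| ≤ C)
    {x : E} {r : ℝ} (h : r < hopfLax c t f x) :
    ∃ b, c b ≠ ⊤ ∧ r < f (x + t • b) - t * (c b).toReal := by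
  by_contra! H
  exact h.not_ge (hopfLax_le ht h0 hf H)

theorem self_le_hopfLax (h0 : c 0 = 0) (hf : ∃ C : ℝ, ∀ x, |f x| ≤ C) (x : E) :
    f x ≤ hopfLax c t f x := by
  by_cases ht : t = 0
  · simp [ht, hopfLax_zero]
  · simpa [h0] using le_hopfLax ht h0 hf x 0 (by simp [h0])

/-- Allowing two base points covers monotonicity and constants (x = y) as well as inheritance of the
modulus (f = g). -/
theorem hopfLax_le_hopfLax_add (h0 : c 0 = 0) (hf : ∃ C : ℝ, ∀ x, |f x| ≤ C)
    (hg : ∃ C : ℝ, ∀ x, |g x| ≤ C) {r : ℝ} {x y : E} (h : ∀ z, f (x + z) ≤ g (y + z) + r) :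
    hopfLax c t f x ≤ hopfLax c t g y + r := by
  by_cases ht : t = 0
  · simpa [ht, hopfLax_zero] using h 0
  · refine hopfLax_le ht h0 hf fun b hb => ?_
    have := le_hopfLax ht h0 hg y b hb
    linarith [h (t • b)]

theorem IsUCb.hopfLax (h0 : c 0 = 0) (hf : IsUCb f) : IsUCb (hopfLax c t f) := by
  refine isUCb_of_modulus hf ?_ fun δ ε h x y hxy => ?_
  · obtain ⟨C, hC⟩ := hf.2
    refine ⟨C, fun x => abs_le.2 ⟨?_, ?_⟩⟩
    · exact (abs_le.1 (hC x)).1.trans (self_le_hopfLax h0 hf.2 x)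
    · by_cases ht : t = 0
      · simpa [ht, hopfLax_zero] using (abs_le.1 (hC x)).2
      · refine hopfLax_le ht h0 hf.2 fun b _ => ?_
        have : 0 ≤ (t : ℝ) * (c b).toReal := by positivity
        linarith [(abs_le.1 (hC (x + t • b))).2]
  · exact hopfLax_le_hopfLax_add h0 hf.2 hf.2 fun z => h _ _ (by simpa using hxy)

end HopfLax

section Transition

variable [MeasurableSpace E] [BorelSpace E] {μ : Measure E} [IsProbabilityMeasure μ] {f g : E → ℝ}

theorem IsUCb.integrable_comp {Ω : Type*} {mΩ : MeasurableSpace Ω} {P : Measure Ω}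
    [IsFiniteMeasure P] (hf : IsUCb f) {X : Ω → E} (hX : AEMeasurable X P) :
    Integrable (fun ω => f (X ω)) P := by
  obtain ⟨C, hC⟩ := hf.2
  exact Integrable.of_bound
    (hf.continuous.measurable.comp_aemeasurable hX).aestronglyMeasurable C
    (Eventually.of_forall fun ω => hC _)

theorem IsUCb.integrable_translate (hf : IsUCb f) (x : E) : Integrable (fun y => f (x + y)) μ :=
  hf.integrable_comp (measurable_const_add x).aemeasurable

theorem transition_le_transition_add (hf : IsUCb f) (hg : IsUCb g) {r : ℝ} {x y : E}
    (h : ∀ z, f (x + z) ≤ g (y + z) + r) : transition μ f x ≤ transition μ g y + r := by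
  have : transition μ g y + r = ∫ z, (g (y + z) + r) ∂μ := by
    rw [integral_add (hg.integrable_translate y) (integrable_const _)]; simp [transition]
  rw [this]
  exact integral_mono (hf.integrable_translate x)
    ((hg.integrable_translate y).add (integrable_const _)) h

theorem IsUCb.transition (hf : IsUCb f) : IsUCb (transition μ f) := by
  refine isUCb_of_modulus hf ?_ fun δ ε h x y hxy => ?_
  · obtain ⟨C, hC⟩ := hf.2
    refine ⟨C, fun x => ?_⟩
    have := norm_integral_le_of_norm_le_const (μ := μ) (f := fun y => f (x + y)) (C := C)
      (Eventually.of_forall fun y => hC _)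
    simpa [LevyControl.transition] using this
  · exact transition_le_transition_add hf hf fun z => h _ _ (by simpa using hxy)

end Transition

/-! ### Comparison of the two splittings -/

section Splitting

variable [NormedSpace ℝ E] [MeasurableSpace E] {c : E → ℝ≥0∞}
  {μ : ℝ≥0 → Measure E} {t : ℝ≥0} {f g : E → ℝ}

theorem opI_of_ne_zero (ht : t ≠ 0) (f : E → ℝ) :
    opI c μ t f = transition (μ t) (hopfLax c t f) := by
  simp [opI, ht]

theorem opJ_of_ne_zero (ht : t ≠ 0) (f : E → ℝ) :
    opJ c μ t f = hopfLax c t (transition (μ t) f) := by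
  simp [opJ, ht]

theorem iterate_opI_zero (n : ℕ) (f : E → ℝ) : (opI c μ 0)^[n] f = f := by
  rw [show opI c μ 0 = id from funext fun f => by simp [opI]]; simp

theorem iterate_opJ_zero (n : ℕ) (f : E → ℝ) : (opJ c μ 0)^[n] f = f := by
  rw [show opJ c μ 0 = id from funext fun f => by simp [opJ]]; simp

/-- Rebracketing (μΦ)^(n+1) = μ(Φμ)^nΦ: the two splittings differ only in where the outermost and
innermost factors stand. -/
theorem iterate_opI_succ (ht : t ≠ 0) (n : ℕ) (f : E → ℝ) :
    (opI c μ t)^[n + 1] f = transition (μ t) ((opJ c μ t)^[n] (hopfLax c t f)) := by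
  induction n generalizing f with
  | zero => simp [opI_of_ne_zero ht]
  | succ n ih =>
    rw [Function.iterate_succ_apply, ih, opI_of_ne_zero ht, Function.iterate_succ_apply,
      opJ_of_ne_zero ht]

variable [BorelSpace E]

theorem IsUCb.opI [IsProbabilityMeasure (μ t)] (h0 : c 0 = 0) (ht : t ≠ 0) (hf : IsUCb f) :
    IsUCb (opI c μ t f) := by
  rw [opI_of_ne_zero ht]; exact (hf.hopfLax h0).transition

theorem IsUCb.opJ [IsProbabilityMeasure (μ t)] (h0 : c 0 = 0) (ht : t ≠ 0) (hf : IsUCb f) :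
    IsUCb (opJ c μ t f) := by
  rw [opJ_of_ne_zero ht]; exact hf.transition.hopfLax h0

theorem IsUCb.iterate_opJ [IsProbabilityMeasure (μ t)] (h0 : c 0 = 0) (ht : t ≠ 0)
    (hf : IsUCb f) (n : ℕ) : IsUCb ((LevyControl.opJ c μ t)^[n] f) := by
  induction n with
  | zero => exact hf
  | succ n ih => rw [Function.iterate_succ_apply']; exact ih.opJ h0 ht

theorem iterate_opJ_le_add [IsProbabilityMeasure (μ t)] (h0 : c 0 = 0) (ht : t ≠ 0)
    (hf : IsUCb f) (hg : IsUCb g) {r : ℝ} (h : ∀ x, f x ≤ g x + r) (n : ℕ) (x : E) :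
    (opJ c μ t)^[n] f x ≤ (opJ c μ t)^[n] g x + r := by
  induction n generalizing x with
  | zero => exact h x
  | succ n ih =>
    simp only [Function.iterate_succ_apply', opJ_of_ne_zero ht]
    have hf' := hf.iterate_opJ (μ := μ) h0 ht n
    have hg' := hg.iterate_opJ (μ := μ) h0 ht n
    exact hopfLax_le_hopfLax_add h0 hf'.transition.2 hg'.transition.2 fun z =>
      transition_le_transition_add hf' hg' fun w => ih _

/-- The splitting error is controlled by a single Hopf-Lax step. -/
theorem iterate_opI_le_iterate_opJ_add [IsProbabilityMeasure (μ t)] (h0 : c 0 = 0) (ht : t ≠ 0)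
    (hf : IsUCb f) {r : ℝ} (h : ∀ x, hopfLax c t f x ≤ f x + r) {n : ℕ} (hn : 1 ≤ n) (x : E) :
    (opI c μ t)^[n] f x ≤ (opJ c μ t)^[n] f x + r := by
  obtain ⟨n, rfl⟩ := Nat.exists_eq_add_of_le' hn
  have hJ := hf.iterate_opJ (μ := μ) h0 ht n
  rw [iterate_opI_succ ht, Function.iterate_succ_apply', opJ_of_ne_zero ht]
  -- μ J^n Φ f ≤ μ J^n f + r ≤ Φ μ J^n f + r; the last inequality holds because standing still is
  -- free.
  refine (transition_le_transition_add (y := x) ((hf.hopfLax h0).iterate_opJ h0 ht n) hJ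
    fun z => iterate_opJ_le_add h0 ht (hf.hopfLax h0) hf h n _).trans ?_
  exact add_le_add_left (self_le_hopfLax h0 hJ.transition.2 x) r

end Splitting

/-! ### Size of one Hopf-Lax step -/

section Conjugate

variable [NormedSpace ℝ E] {c : E → ℝ≥0∞}

/-- Superlinearity gives c(a) ≥ b‖a‖ outside a ball; inside, b‖a‖ is bounded by b times the radius.
Hence c̄(b) is finite, and a = 0 makes it nonnegative. -/
theorem IsCost.sub_le_conj (hc : IsCost c) {b : ℝ} (hb : 0 ≤ b) :
    ∃ K : ℝ, 0 ≤ K ∧ conj c b = K ∧ ∀ a, c a ≠ ⊤ → b * ‖a‖ - (c a).toReal ≤ K := by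
  have hlt : ∀ᶠ a in Bornology.cobounded E, ENNReal.ofReal b < c a / ‖a‖ₑ :=
    hc.superlinear.eventually (lt_mem_nhds ENNReal.ofReal_lt_top)
  obtain ⟨R, hR⟩ := (hasBasis_cobounded_norm (E := E)).eventually_iff.1 hlt
  have hbound : ∀ a, (((b * ‖a‖ : ℝ) : EReal) - (c a : EReal)) ≤ ((b * max R 0 : ℝ) : EReal) := by
    intro a
    refine EReal.sub_le_of_le_add' ?_
    rcases le_or_gt R ‖a‖ with h | h
    · have h1 := (ENNReal.mul_le_of_le_div (hR.2 h).le)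
      have h2 : (((b * ‖a‖ : ℝ) : EReal)) ≤ (c a : EReal) := by
        have : ENNReal.ofReal (b * ‖a‖) ≤ c a := by
          rw [ENNReal.ofReal_mul hb, ofReal_norm]; exact h1
        have h3 := EReal.coe_ennreal_le_coe_ennreal_iff.2 this
        rwa [EReal.coe_ennreal_ofReal, max_eq_left (by positivity)] at h3
      refine h2.trans (le_add_of_nonneg_right ?_)
      exact_mod_cast (by positivity : 0 ≤ b * max R 0)
    · refine le_trans ?_ (le_add_of_nonneg_left (EReal.coe_ennreal_nonneg _))
      exact_mod_cast mul_le_mul_of_nonneg_left (h.le.trans (le_max_left _ _)) hb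
  have hle : conj c b ≤ ((b * max R 0 : ℝ) : EReal) := iSup_le hbound
  have hge : (0 : EReal) ≤ conj c b := le_iSup_of_le 0 (by simp [hc.zero])
  lift conj c b to ℝ using ⟨ne_top_of_le_ne_top (EReal.coe_ne_top _) hle,
    ne_bot_of_le_ne_bot EReal.zero_ne_bot hge⟩ with K hK
  refine ⟨K, by exact_mod_cast hge, rfl, fun a ha => ?_⟩
  rw [← EReal.coe_le_coe_iff, hK]
  refine le_trans (le_of_eq ?_) (le_iSup _ a)
  exact (coe_sub_coe_ennreal _ ha).symm

variable {t : ℝ≥0} {f : E → ℝ}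

/-- A Hopf-Lax step increases `f` by at most `max ε (t c̄(b))` if the increments of `f` are at
most `max ε (b ‖·‖)`. -/
theorem hopfLax_le_add_max (h0 : c 0 = 0) (ht : t ≠ 0) (hf : IsUCb f) {b K ε : ℝ}
    (hK : ∀ a, c a ≠ ⊤ → b * ‖a‖ - (c a).toReal ≤ K)
    (h : ∀ x a, f (x + a) - f x ≤ max ε (b * ‖a‖)) (x : E) :
    hopfLax c t f x ≤ f x + max ε (t * K) := by
  refine hopfLax_le ht h0 hf.2 fun a ha => ?_
  have hc0 : 0 ≤ t * (c a).toReal := by positivity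
  have h1 := h x (t • a)
  -- Either the increment is at most ε and the cost only helps, or the gain is at most t(b‖a‖ -
  -- c(a)) ≤ tK.
  rcases le_max_iff.1 h1 with h2 | h2
  · linarith [le_max_left ε (t * K)]
  · have h3 := mul_le_mul_of_nonneg_left (hK a ha) t.coe_nonneg
    have h4 : ‖t • a‖ = t * ‖a‖ := by simp [NNReal.smul_def, norm_smul]
    rw [h4] at h2
    nlinarith [le_max_right ε (t * K)]

end Conjugate

section Modulus

variable {f : E → ℝ}

theorem sub_le_lipSeminorm_mul (hf : lipSeminorm f < ⊤) (x a : E) :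
    f (x + a) - f x ≤ (lipSeminorm f).toReal * ‖a‖ := by
  by_cases ha : a = 0
  · simp [ha]
  have h1 : ‖f (x + a) - f x‖ₑ / ‖(x + a) - x‖ₑ ≤ lipSeminorm f :=
    le_iSup₂ (f := fun x y : E => ‖f x - f y‖ₑ / ‖x - y‖ₑ) (x + a) x
  rw [add_sub_cancel_left, ENNReal.div_le_iff (by simpa using ha) (by simp)] at h1
  have h2 := ENNReal.toReal_mono (ENNReal.mul_ne_top hf.ne (by simp)) h1
  rw [ENNReal.toReal_mul] at h2
  simp only [toReal_enorm] at h2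
  exact (le_abs_self _).trans h2

theorem IsUCb.invModulus_ne_zero (hf : IsUCb f) {ε : ℝ} (hε : 0 < ε) : invModulus f ε ≠ 0 := by
  obtain ⟨δ, hδ, H⟩ := Metric.uniformContinuous_iff.1 hf.1 ε hε
  have hle : ENNReal.ofReal (δ / 2) ≤ invModulus f ε :=
    le_sSup ⟨δ / 2, half_pos hδ, fun x y hxy => ?_, rfl⟩
  · exact (lt_of_lt_of_le (by simpa using hδ) hle).ne'
  · have := H (a := x) (b := y) (by rw [dist_eq_norm]; linarith)
    rw [Real.dist_eq] at this; exact this.le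

theorem IsUCb.oscillation_ne_top (hf : IsUCb f) : oscillation f ≠ ⊤ := by
  obtain ⟨C, hC⟩ := hf.2
  refine ne_top_of_le_ne_top (ENNReal.ofReal_ne_top (r := C + C)) (iSup₂_le fun x y => ?_)
  rw [← ofReal_norm]
  exact ENNReal.ofReal_le_ofReal ((norm_sub_le _ _).trans (add_le_add (hC x) (hC y)))

/-- Displacements shorter than ω⁻¹(ε) change f by at most ε. For longer ones var f ≤ (var f /
ω⁻¹(ε))‖a‖. -/
theorem IsUCb.sub_le_max (hf : IsUCb f) {ε : ℝ} (hε : 0 < ε) (x a : E) :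
    f (x + a) - f x ≤ max ε ((oscillation f / invModulus f ε).toReal * ‖a‖) := by
  by_cases h : ENNReal.ofReal ‖a‖ < invModulus f ε
  · obtain ⟨_, ⟨δ, hδ, H, rfl⟩, hlt⟩ := lt_sSup_iff.1 h
    have := H (x + a) x (by simpa using ((ENNReal.ofReal_lt_ofReal_iff hδ).1 hlt).le)
    exact (le_abs_self _).trans (this.trans (le_max_left _ _))
  · refine le_trans ?_ (le_max_right _ _)
    have hm0 := hf.invModulus_ne_zero hε
    have h1 : ‖f (x + a) - f x‖ₑ ≤ oscillation f :=
      le_iSup₂ (f := fun x y : E => ‖f x - f y‖ₑ) (x + a) x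
    have h2 : oscillation f ≤ oscillation f / invModulus f ε * ENNReal.ofReal ‖a‖ := by
      -- Here ω⁻¹(ε) ≤ ‖a‖ is finite, as the cancellation requires; an infinite value falls under
      -- the first case.
      rw [not_lt] at h
      calc oscillation f = oscillation f / invModulus f ε * invModulus f ε :=
            (ENNReal.div_mul_cancel hm0 (ne_top_of_le_ne_top ENNReal.ofReal_ne_top h)).symm
        _ ≤ _ := by gcongr
    have h3 := ENNReal.toReal_mono (ENNReal.mul_ne_top
      (ENNReal.div_ne_top hf.oscillation_ne_top hm0) ENNReal.ofReal_ne_top) (h1.trans h2)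
    rw [ENNReal.toReal_mul, toReal_enorm, ENNReal.toReal_ofReal (norm_nonneg _)] at h3
    exact (le_abs_self _).trans h3

end Modulus

end Operators

/-! ### Measurability of time integrals of adapted processes -/

section AdaptedIntegral

variable {E Ω S : Type*} [NormedAddCommGroup E] [NormedSpace ℝ E] [CompleteSpace E]
  {m mΩ : MeasurableSpace Ω} {P : Measure Ω} [IsProbabilityMeasure P]

/-- Against an m-measurable factor, a weight may be replaced by its conditional expectation. -/
theorem integral_smul_eq_integral_condExp_smul (hm : m ≤ mΩ) {ξ : Ω → ℝ} {g : Ω → E}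
    (hξ : Integrable ξ P) (hg : AEStronglyMeasurable[m] g P)
    (hi : Integrable (ξ • g) P) : ∫ ω, ξ ω • g ω ∂P = ∫ ω, P[ξ|m] ω • g ω ∂P := by
  rw [show (∫ ω, ξ ω • g ω ∂P) = ∫ ω, P[ξ • g|m] ω ∂P from (integral_condExp hm).symm]
  exact integral_congr_ae (condExp_smul_of_aestronglyMeasurable_right hξ hi hg)

variable [MeasurableSpace S] {ν : Measure S} [IsFiniteMeasure ν]

/-- The time integral of a bounded jointly measurable family of `m`-measurable random variables
is almost surely `m`-measurable. -/
theorem aestronglyMeasurable_integral_of_bound (hm : m ≤ mΩ) {β : S → Ω → E}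
    (hβ : StronglyMeasurable (Function.uncurry β))
    (hβm : ∀ᵐ u ∂ν, StronglyMeasurable[m] (β u)) {C : ℝ} (hC : ∀ u ω, ‖β u ω‖ ≤ C) :
    AEStronglyMeasurable[m] (fun ω => ∫ u, β u ω ∂ν) P := by
  set A : Ω → E := fun ω => ∫ u, β u ω ∂ν with hA
  have hAm : StronglyMeasurable A := hβ.integral_prod_left
  have hAb : ∀ ω, ‖A ω‖ ≤ C * ν.real Set.univ := fun ω =>
    norm_integral_le_of_norm_le_const (Eventually.of_forall fun u => hC u ω)
  have hAi : Integrable A P :=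
    Integrable.of_bound hAm.aestronglyMeasurable _ (Eventually.of_forall hAb)
  have hβi : ∀ u, Integrable (β u) P := fun u =>
    Integrable.of_bound (hβ.comp_measurable measurable_prodMk_left).aestronglyMeasurable C
      (Eventually.of_forall (hC u))
  have hswap : ∀ ξ : Ω → ℝ, Integrable ξ P →
      ∫ ω, ξ ω • A ω ∂P = ∫ u, ∫ ω, ξ ω • β u ω ∂P ∂ν := fun ξ hξ => by
    simp_rw [hA, ← integral_smul]
    refine integral_integral_swap (f := fun ω u => ξ ω • β u ω) ?_
    have h1 : Integrable (fun z : Ω × S => ξ z.1) (P.prod ν) := hξ.comp_fst ν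
    refine Integrable.mono' (h1.norm.mul_const C)
      (h1.aestronglyMeasurable.smul (hβ.comp_measurable measurable_swap).aestronglyMeasurable)
      (Eventually.of_forall fun z => ?_)
    rw [Function.uncurry, norm_smul]
    exact mul_le_mul_of_nonneg_left (hC _ _) (norm_nonneg _)
  have hsmul : ∀ (ξ : Ω → ℝ) (g : Ω → E) (D : ℝ), Integrable ξ P → AEStronglyMeasurable g P →
      (∀ ω, ‖g ω‖ ≤ D) → Integrable (ξ • g) P := fun ξ g D hξ hg hD => by
    refine Integrable.mono' (hξ.norm.mul_const D) (hξ.aestronglyMeasurable.smul hg)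
      (Eventually.of_forall fun z => ?_)
    rw [Pi.smul_apply', norm_smul]
    exact mul_le_mul_of_nonneg_left (hD _) (norm_nonneg _)
  -- With ξ the indicator of B, Fubini moves the conditioning of ξ from each β_u to A: E[ξA] =
  -- E[E[ξ|m] A] = E[E[ξ|m] E[A|m]] = E[ξ E[A|m]]. As B is any event, A equals E[A|m] almost surely.
  have key : A =ᵐ[P] P[A|m] := by
    refine hAi.ae_eq_of_forall_setIntegral_eq _ _ integrable_condExp fun B hB _ => ?_
    set ξ : Ω → ℝ := B.indicator fun _ => 1 with hξ
    have hξi : Integrable ξ P := (integrable_const _).indicator hB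
    have hset : ∀ g : Ω → E, ∫ ω in B, g ω ∂P = ∫ ω, ξ ω • g ω ∂P := fun g => by
      rw [← integral_indicator hB]
      congr 1; funext ω
      by_cases h : ω ∈ B <;> simp [hξ, h]
    have hL : ∫ ω, ξ ω • A ω ∂P = ∫ ω, P[ξ|m] ω • A ω ∂P := by
      rw [hswap _ hξi, hswap _ integrable_condExp]
      refine integral_congr_ae ?_
      filter_upwards [hβm] with u hu
      exact integral_smul_eq_integral_condExp_smul hm hξi hu.aestronglyMeasurable
        (hsmul ξ _ C hξi (hβi u).aestronglyMeasurable (hC u))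
    have hR : ∫ ω, ξ ω • P[A|m] ω ∂P = ∫ ω, P[ξ|m] ω • P[A|m] ω ∂P := by
      refine integral_smul_eq_integral_condExp_smul hm hξi
        stronglyMeasurable_condExp.aestronglyMeasurable ?_
      have : ξ • P[A|m] = B.indicator (P[A|m]) := by
        funext ω; by_cases h : ω ∈ B <;> simp [hξ, h]
      rw [this]
      exact integrable_condExp.indicator hB
    have hM : ∫ ω, P[ξ|m] ω • A ω ∂P = ∫ ω, P[ξ|m] ω • P[A|m] ω ∂P := by
      have hi := hsmul (P[ξ|m]) A _ integrable_condExp hAi.aestronglyMeasurable hAb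
      rw [show (∫ ω, P[ξ|m] ω • A ω ∂P) = ∫ ω, P[(P[ξ|m]) • A|m] ω ∂P from
        (integral_condExp hm).symm]
      exact integral_congr_ae (condExp_smul_of_aestronglyMeasurable_left
        stronglyMeasurable_condExp.aestronglyMeasurable hi hAi)
    rw [hset, hset, hL, hR, hM]
  exact stronglyMeasurable_condExp.aestronglyMeasurable.congr key.symm

variable [MeasurableSpace E] [BorelSpace E] [SecondCountableTopology E]

/-- Truncation reduces to bounded integrands, and dominated convergence removes it. -/
theorem aestronglyMeasurable_integral (hm : m ≤ mΩ) {β : S → Ω → E}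
    (hβ : Measurable (Function.uncurry β)) (hβm : ∀ᵐ u ∂ν, Measurable[m] (β u))
    (hi : ∀ᵐ ω ∂P, Integrable (fun u => β u ω) ν) :
    AEStronglyMeasurable[m] (fun ω => ∫ u, β u ω ∂ν) P := by
  let T : ℕ → E → E := fun n => (Metric.closedBall (0 : E) n).indicator id
  have hTm : ∀ n, Measurable (T n) := fun n =>
    measurable_id.indicator Metric.isClosed_closedBall.measurableSet
  have hTn : ∀ n x, ‖T n x‖ ≤ ‖x‖ := fun n x => norm_indicator_le_norm_self _ _
  have hTb : ∀ (n : ℕ) x, ‖T n x‖ ≤ n := fun n x => by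
    by_cases h : x ∈ Metric.closedBall (0 : E) n
    · rw [show T n x = x from Set.indicator_of_mem h _]; simpa using h
    · simp [T, h]
  have hTlim : ∀ x, Tendsto (fun n => T n x) atTop (𝓝 x) := fun x => by
    obtain ⟨N, hN⟩ := exists_nat_ge ‖x‖
    refine tendsto_const_nhds.congr' (eventually_atTop.2 ⟨N, fun n hn => ?_⟩)
    have : x ∈ Metric.closedBall (0 : E) n := by
      simpa using hN.trans (Nat.cast_le.2 hn)
    simp [T, this]
  have hT : ∀ n : ℕ, AEStronglyMeasurable[m] (fun ω => ∫ u, T n (β u ω) ∂ν) P := fun n =>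
    aestronglyMeasurable_integral_of_bound hm (β := fun u ω => T n (β u ω))
      ((hTm n).comp hβ).stronglyMeasurable
      (hβm.mono fun u hu => ((hTm n).comp hu).stronglyMeasurable) fun u ω => hTb n _
  -- The limit is taken over m-measurable versions, so it is m-measurable everywhere and equals the
  -- integral almost surely.
  refine ⟨fun ω => limUnder atTop fun n => (hT n).mk _ ω,
    @StronglyMeasurable.limUnder _ _ _ m _ _ _ _ _ _ _ fun n => (hT n).stronglyMeasurable_mk, ?_⟩
  filter_upwards [hi, ae_all_iff.2 fun n => (hT n).ae_eq_mk] with ω hω hmk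
  simp_rw [← hmk]
  refine (Tendsto.limUnder_eq ?_).symm
  refine tendsto_integral_of_dominated_convergence (fun u => ‖β u ω‖) (fun n => ?_) hω.norm
    (fun n => Eventually.of_forall fun u => hTn n _) (Eventually.of_forall fun u => hTlim _)
  exact ((hTm n).comp (hβ.comp measurable_prodMk_right)).aestronglyMeasurable

end AdaptedIntegral

/-! ### Averaging out an independent increment -/

section Independence

variable {E Ω : Type*} [NormedAddCommGroup E] [SecondCountableTopology E] [MeasurableSpace E]
  [BorelSpace E] {m mΩ : MeasurableSpace Ω} {P : Measure Ω} [IsProbabilityMeasure P]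

/-- An m-measurable version of X is independent of D, so their joint law is a product and Fubini
applies. -/
theorem integral_add_eq_integral_transition (hm : m ≤ mΩ) {X D : Ω → E} {μ : Measure E} {g : E → ℝ}
    (hX : AEStronglyMeasurable[m] X P) (hD : Measurable D) (hlaw : P.map D = μ)
    (hind : Indep (MeasurableSpace.comap D inferInstance) m P) (hg : IsUCb g) :
    ∫ ω, g (X ω + D ω) ∂P = ∫ ω, transition μ g (X ω) ∂P := by
  obtain ⟨X', hX', hXX'⟩ := hX
  have hX'm : Measurable X' := (hX'.mono hm).measurable
  have hi : IndepFun X' D P := by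
    rw [IndepFun_iff_Indep]
    exact (indep_of_indep_of_le_right hind hX'.measurable.comap_le).symm
  have h1 : ∫ ω, g (X ω + D ω) ∂P = ∫ ω, g (X' ω + D ω) ∂P :=
    integral_congr_ae (hXX'.mono fun ω h => by simp only [h])
  have h2 : ∫ ω, transition μ g (X ω) ∂P = ∫ ω, transition μ g (X' ω) ∂P :=
    integral_congr_ae (hXX'.mono fun ω h => by simp only [h])
  have : IsProbabilityMeasure μ := hlaw ▸ Measure.isProbabilityMeasure_map hD.aemeasurable
  have : IsProbabilityMeasure (P.map X') := Measure.isProbabilityMeasure_map hX'm.aemeasurable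
  have hmap := (indepFun_iff_map_prod_eq_prod_map_map hX'm.aemeasurable hD.aemeasurable).1 hi
  rw [hlaw] at hmap
  have hgm : Measurable fun z : E × E => g (z.1 + z.2) :=
    hg.continuous.measurable.comp (measurable_fst.add measurable_snd)
  rw [h1, h2, ← integral_map (φ := fun ω => (X' ω, D ω)) (f := fun z : E × E => g (z.1 + z.2))
    (hX'm.prodMk hD).aemeasurable hgm.aestronglyMeasurable, hmap,
    integral_prod _ (hg.integrable_comp (X := fun z : E × E => z.1 + z.2)
      (measurable_fst.add measurable_snd).aemeasurable),
    ← integral_map (f := transition μ g) hX'm.aemeasurable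
      hg.transition.continuous.measurable.aestronglyMeasurable]
  rfl

end Independence

/-! ### Jensen's inequality for costs that need not be measurable -/

section Jensen

variable {E : Type*} [NormedAddCommGroup E]

/-- The lower semicontinuous envelope of a cost function. -/
noncomputable def lscEnvelope (c : E → ℝ≥0∞) (a : E) : ℝ≥0∞ := liminf c (𝓝 a)

variable {c : E → ℝ≥0∞}

/-- This makes the envelope Borel. A bound c > r' near a persists around every b close to a, so it
bounds the envelope there. -/
theorem lowerSemicontinuous_lscEnvelope : LowerSemicontinuous (lscEnvelope c) := by
  intro a r hr
  obtain ⟨r', h1, h2⟩ := exists_between hr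
  filter_upwards [(eventually_lt_of_lt_liminf h2).eventually_nhds] with b hb
  exact h1.trans_le (le_liminf_of_le (by isBoundedDefault) (hb.mono fun _ h => h.le))

theorem lscEnvelope_le (a : E) : lscEnvelope c a ≤ c a := by
  have h : ∃ᶠ b in pure a, c b ≤ c a := frequently_pure.2 le_rfl
  exact liminf_le_of_frequently_le (h.filter_mono (pure_le_nhds a)) (by isBoundedDefault)

/-- The epigraph of a cost function. -/
def epigraph (c : E → ℝ≥0∞) : Set (E × ℝ) := {p | 0 ≤ p.2 ∧ c p.1 ≤ ENNReal.ofReal p.2}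

/-- Values of c within ε/2 above the envelope occur arbitrarily close to a. The graph of the
envelope thus lies in a closed set, convex when c is. -/
theorem mem_closure_epigraph {a : E} (ha : lscEnvelope c a ≠ ⊤) :
    (a, (lscEnvelope c a).toReal) ∈ closure (epigraph c) := by
  rw [Metric.mem_closure_iff]
  intro ε hε
  have hlt : lscEnvelope c a < ENNReal.ofReal ((lscEnvelope c a).toReal + ε / 2) := by
    rw [← ENNReal.ofReal_toReal ha, ENNReal.toReal_ofReal ENNReal.toReal_nonneg,
      ENNReal.ofReal_lt_ofReal_iff (by positivity)]
    linarith
  obtain ⟨b, hb, hba⟩ := ((frequently_lt_of_liminf_lt (by isBoundedDefault) hlt).and_eventually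
    (Metric.ball_mem_nhds a hε)).exists
  refine ⟨(b, _), ⟨by positivity, hb.le⟩, ?_⟩
  rw [Prod.dist_eq, max_lt_iff, Real.dist_eq]
  refine ⟨by rwa [dist_comm], ?_⟩
  simp only [sub_add_cancel_left, abs_neg]
  rw [abs_of_pos (by positivity)]
  linarith

variable [NormedSpace ℝ E]

theorem IsCost.convex_epigraph (hc : IsCost c) : Convex ℝ (epigraph c) := by
  rintro ⟨x, r⟩ ⟨hr, hx⟩ ⟨y, q⟩ ⟨hq, hy⟩ a b ha hb hab
  refine ⟨add_nonneg (mul_nonneg ha hr) (mul_nonneg hb hq), ?_⟩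
  lift a to ℝ≥0 using ha
  lift b to ℝ≥0 using hb
  have h := hc.convex.2 (Set.mem_univ x) (Set.mem_univ y) zero_le zero_le
    (by exact_mod_cast hab)
  refine h.trans ?_
  change _ ≤ ENNReal.ofReal (a * r + b * q)
  change 0 ≤ r at hr
  change 0 ≤ q at hq
  rw [ENNReal.ofReal_add (mul_nonneg a.coe_nonneg hr) (mul_nonneg b.coe_nonneg hq), ENNReal.ofReal_mul a.coe_nonneg,
    ENNReal.ofReal_mul b.coe_nonneg]
  simp only [ENNReal.smul_def, smul_eq_mul, ENNReal.ofReal_coe_nnreal]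
  exact add_le_add (mul_le_mul_right hx _) (mul_le_mul_right hy _)

variable [CompleteSpace E] [MeasurableSpace E] [BorelSpace E] {S : Type*} [MeasurableSpace S]
  {ν : Measure S} [IsFiniteMeasure ν] {t : ℝ≥0} {f : E → ℝ}

/-- Jensen's inequality in Hopf-Lax form. -/
theorem IsCost.le_hopfLax_add_lintegral (hc : IsCost c) (ht : t ≠ 0) (hν : ν Set.univ = t)
    (hf : IsUCb f) {β : S → E} (hβm : Measurable β) (hβ : Integrable β ν)
    (hcost : ∫⁻ u, lscEnvelope c (β u) ∂ν ≠ ⊤) (x : E) :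
    f (x + ∫ u, β u ∂ν) ≤ hopfLax c t f x + (∫⁻ u, lscEnvelope c (β u) ∂ν).toReal := by
  have hm : Measurable fun u => lscEnvelope c (β u) :=
    lowerSemicontinuous_lscEnvelope.measurable.comp hβm
  have hfin : ∀ᵐ u ∂ν, lscEnvelope c (β u) < ⊤ := ae_lt_top hm hcost
  have hreal : ν.real Set.univ = t := by simp [Measure.real, hν]
  have ht' : (t : ℝ) ≠ 0 := by exact_mod_cast ht
  have : NeZero ν := ⟨fun h => ht (by simpa [h] using hν.symm)⟩
  have hi := integrable_toReal_of_lintegral_ne_top hm.aemeasurable hcost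
  -- The average of (β, envelope of c at β) stays in the closed convex set. Since ν has mass t,
  -- multiplying by t recovers the integrals.
  have hmem := hc.convex_epigraph.closure.average_mem isClosed_closure
    (hfin.mono fun u hu => mem_closure_epigraph hu.ne) (hβ.prodMk hi)
  rw [average_pair hβ hi, average_eq, average_eq, hreal] at hmem
  -- The Hopf-Lax inequality holds on the epigraph and, f being continuous, is a closed condition.
  have hsub : closure (epigraph c) ⊆ {p | f (x + (t : ℝ) • p.1) - t * p.2 ≤ hopfLax c t f x} := by
    refine closure_minimal ?_ ?_
    · rintro ⟨a, r⟩ ⟨hr, ha⟩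
      have h1 := le_hopfLax ht hc.zero hf.2 x a (ne_top_of_le_ne_top ENNReal.ofReal_ne_top ha)
      have h2 : (c a).toReal ≤ r := ENNReal.toReal_le_of_le_ofReal hr ha
      have h3 := mul_le_mul_of_nonneg_left h2 t.coe_nonneg
      have h4 : f (x + (t : ℝ) • a) = f (x + t • a) := rfl
      simp only [Set.mem_ofPred_eq]
      linarith
    · have := hf.continuous
      exact isClosed_le (by fun_prop) continuous_const
  have h := hsub hmem
  simp only [Set.mem_ofPred_eq, smul_inv_smul₀ ht', smul_eq_mul, mul_inv_cancel_left₀ ht'] at h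
  rw [integral_toReal hm.aemeasurable hfin] at h
  linarith

end Jensen

/-! ### Upper bound for every control -/

section Upper

variable {E : Type*} [NormedAddCommGroup E] [MeasurableSpace E] {c : E → ℝ≥0∞}
  {Ω : Type*} {mΩ : MeasurableSpace Ω} {P : Measure Ω} {ℱ : Filtration ℝ≥0 mΩ}
  {Y α : ℝ≥0 → Ω → E} {μ : ℝ≥0 → Measure E} {f g : E → ℝ}

theorem IsControl.measurable_toNNReal (hα : IsControl P ℱ α) :
    Measurable (Function.uncurry fun (u : ℝ) ω => α u.toNNReal ω) :=
  hα.measurable.comp ((measurable_real_toNNReal.comp measurable_fst).prodMk measurable_snd)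

/-- The expected cost accumulated on `(s, t]` for the lower semicontinuous envelope of `c`. -/
noncomputable def envelopeCost (P : Measure Ω) (c : E → ℝ≥0∞) (α : ℝ≥0 → Ω → E) (s t : ℝ≥0) :
    ℝ≥0∞ :=
  ∫⁻ ω, (∫⁻ u in Set.Ioc (s : ℝ) t, lscEnvelope c (α u.toNNReal ω)) ∂P

variable [BorelSpace E]

theorem IsLevyProcess.map_increment (hY : IsLevyProcess P ℱ Y) {h : ℝ≥0}
    (hμ : HasLaw (Y h) (μ h) P) (s : ℝ≥0) : P.map (fun ω => Y (s + h) ω - Y s ω) = μ h :=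
  (hY.stationary s h).map_eq.trans hμ.map_eq

theorem IsControl.measurable_lscEnvelope (hα : IsControl P ℱ α) :
    Measurable (Function.uncurry fun (u : ℝ) ω => lscEnvelope c (α u.toNNReal ω)) :=
  lowerSemicontinuous_lscEnvelope.measurable.comp hα.measurable_toNNReal

theorem IsControl.envelopeCost_add (hα : IsControl P ℱ α) {s t : ℝ≥0} (hst : s ≤ t) :
    envelopeCost P c α 0 t = envelopeCost P c α 0 s + envelopeCost P c α s t := by
  rw [envelopeCost, envelopeCost, envelopeCost,
    ← lintegral_add_left hα.measurable_lscEnvelope.lintegral_prod_left]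
  congr 1; funext ω
  rw [← Set.Ioc_union_Ioc_eq_Ioc (b := (s : ℝ)) (by simp) (by exact_mod_cast hst),
    lintegral_union measurableSet_Ioc (Set.Ioc_disjoint_Ioc_of_le le_rfl)]

variable [SecondCountableTopology E]

theorem IsLevyProcess.measurable_increment (hY : IsLevyProcess P ℱ Y) (s t : ℝ≥0) :
    Measurable (fun ω => Y t ω - Y s ω) :=
  ((hY.adapted t).mono (ℱ.le t) le_rfl).sub ((hY.adapted s).mono (ℱ.le s) le_rfl)

theorem IsControl.integrableOn (hα : IsControl P ℱ α) :
    ∀ᵐ ω ∂P, ∀ t : ℝ≥0, IntegrableOn (fun u : ℝ => α u.toNNReal ω) (Set.Ioc 0 t) := by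
  filter_upwards [hα.integrable] with ω hω t
  exact ⟨(hα.measurable_toNNReal.comp measurable_prodMk_right).aestronglyMeasurable, hω t⟩

variable [NormedSpace ℝ E] [CompleteSpace E] [IsProbabilityMeasure P]

theorem IsControl.aestronglyMeasurable_controlled (hα : IsControl P ℱ α)
    (hY : IsLevyProcess P ℱ Y) (x : E) (s : ℝ≥0) :
    AEStronglyMeasurable[ℱ s] (controlled Y α x s) P := by
  have h1 : StronglyMeasurable[ℱ s] (fun ω => x + Y s ω) :=
    ((hY.adapted s).const_add x).stronglyMeasurable
  refine h1.aestronglyMeasurable.add ?_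
  refine aestronglyMeasurable_integral (ℱ.le s) hα.measurable_toNNReal ?_
    (hα.integrableOn.mono fun ω h => h s)
  filter_upwards [ae_restrict_mem measurableSet_Ioc] with u hu
  exact (hα.adapted _).mono (ℱ.mono (Real.toNNReal_le_iff_le_coe.2 hu.2)) le_rfl

theorem IsControl.aemeasurable_controlled (hα : IsControl P ℱ α)
    (hY : IsLevyProcess P ℱ Y) (x : E) (s : ℝ≥0) : AEMeasurable (controlled Y α x s) P :=
  ((hα.aestronglyMeasurable_controlled hY x s).mono (ℱ.le s)).aemeasurable

/-- Jensen starts from the state at s shifted by the noise increment, path by path, so the control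
on the interval may depend on that increment. Only afterwards is the increment averaged out. -/
theorem IsControl.integral_controlled_step (hα : IsControl P ℱ α) (hY : IsLevyProcess P ℱ Y)
    (hc : IsCost c) {h : ℝ≥0} (hh : h ≠ 0) (hμ : HasLaw (Y h) (μ h) P) (hg : IsUCb g) (x : E)
    (s : ℝ≥0) (hcost : envelopeCost P c α s (s + h) ≠ ⊤) :
    ∫ ω, g (controlled Y α x (s + h) ω) ∂P ≤
      ∫ ω, opI c μ h g (controlled Y α x s ω) ∂P + (envelopeCost P c α s (s + h)).toReal := by
  have hX := hα.aestronglyMeasurable_controlled hY x s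
  have hD := hY.measurable_increment s (s + h)
  have hΦ : IsUCb (hopfLax c h g) := hg.hopfLax hc.zero
  have hΦi : Integrable
      (fun ω => hopfLax c h g (controlled Y α x s ω + (Y (s + h) ω - Y s ω))) P :=
    hΦ.integrable_comp ((hα.aemeasurable_controlled hY x s).add hD.aemeasurable)
  have hKm : Measurable fun ω => ∫⁻ u in Set.Ioc (s : ℝ) (s + h : ℝ≥0),
      lscEnvelope c (α u.toNNReal ω) := hα.measurable_lscEnvelope.lintegral_prod_left
  have hfin := ae_lt_top hKm hcost
  rw [opI_of_ne_zero hh, ← integral_add_eq_integral_transition (ℱ.le s) hX hD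
    (hY.map_increment hμ s) (hY.indep s _ le_self_add) hΦ, envelopeCost,
    ← integral_toReal hKm.aemeasurable hfin, ← integral_add hΦi
      (integrable_toReal_of_lintegral_ne_top hKm.aemeasurable hcost)]
  refine integral_mono_ae (hg.integrable_comp (hα.aemeasurable_controlled hY x _))
    (hΦi.add
      (integrable_toReal_of_lintegral_ne_top hKm.aemeasurable hcost)) ?_
  filter_upwards [hfin, hα.integrableOn] with ω hω hi
  have hsub : Set.Ioc (s : ℝ) (s + h : ℝ≥0) ⊆ Set.Ioc 0 (s + h : ℝ≥0) :=
    Set.Ioc_subset_Ioc_left s.2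
  have hsplit : controlled Y α x (s + h) ω = controlled Y α x s ω + (Y (s + h) ω - Y s ω) +
      ∫ u in Set.Ioc (s : ℝ) (s + h : ℝ≥0), α u.toNNReal ω := by
    rw [controlled, ← Set.Ioc_union_Ioc_eq_Ioc (b := (s : ℝ)) s.2 (by simp),
      setIntegral_union (Set.Ioc_disjoint_Ioc_of_le le_rfl) measurableSet_Ioc (hi s)
        ((hi _).mono_set hsub), controlled]
    abel
  rw [hsplit]
  exact hc.le_hopfLax_add_lintegral hh (by simp) hg
    (hα.measurable_toNNReal.comp measurable_prodMk_right) ((hi _).mono_set hsub) hω.ne _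

theorem IsControl.integral_controlled_le_iterate (hα : IsControl P ℱ α)
    (hY : IsLevyProcess P ℱ Y) (hc : IsCost c) {h : ℝ≥0} (hh : h ≠ 0)
    (hμ : HasLaw (Y h) (μ h) P) (hg : IsUCb g) (x : E) (k : ℕ)
    (hcost : envelopeCost P c α 0 (k * h) ≠ ⊤) :
    ∫ ω, g (controlled Y α x (k * h) ω) ∂P ≤
      (opI c μ h)^[k] g x + (envelopeCost P c α 0 (k * h)).toReal := by
  have : IsProbabilityMeasure (μ h) := hμ.map_eq ▸ Measure.isProbabilityMeasure_map hμ.aemeasurable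
  induction k generalizing g with
  | zero =>
    have : ∫ ω, g (controlled Y α x 0 ω) ∂P = ∫ _, g x ∂P := by
      refine integral_congr_ae ?_
      filter_upwards [hY.zero] with ω hω
      simp [controlled, hω]
    simp [this]
  | succ k ih =>
    have hk : ((k + 1 : ℕ) : ℝ≥0) * h = k * h + h := by push_cast; ring
    rw [hk] at hcost ⊢
    rw [hα.envelopeCost_add le_self_add] at hcost ⊢
    obtain ⟨h1, h2⟩ := ENNReal.add_ne_top.1 hcost
    rw [ENNReal.toReal_add h1 h2, Function.iterate_succ_apply]
    -- The last interval is removed first; induction then applies to `opI c μ h g`.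
    have := hα.integral_controlled_step hY hc hh hμ hg x _ h2
    linarith [ih (hg.opI (μ := μ) hc.zero hh) h1]

theorem value_le_iterate_opI (hY : IsLevyProcess P ℱ Y) (hc : IsCost c) {h : ℝ≥0} (hh : h ≠ 0)
    (hμ : HasLaw (Y h) (μ h) P) (hf : IsUCb f) (x : E) (k : ℕ) :
    value P ℱ Y c (k * h) f x ≤ (((opI c μ h)^[k] f x : ℝ) : EReal) := by
  refine iSup₂_le fun α hα => ?_
  have hle : envelopeCost P c α 0 (k * h) ≤ ∫⁻ ω, runningCost c α (k * h) ω ∂P :=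
    lintegral_mono fun ω => lintegral_mono fun u => lscEnvelope_le _
  by_cases hcost : ∫⁻ ω, runningCost c α (k * h) ω ∂P = ⊤
  · simp [hcost]
  · rw [coe_sub_coe_ennreal _ hcost, EReal.coe_le_coe_iff]
    have := hα.integral_controlled_le_iterate hY hc hh hμ hf x k (ne_top_of_le_ne_top hcost hle)
    linarith [ENNReal.toReal_mono hcost hle]

end Upper

/-! ### Lower bound by controls built interval by interval -/

section Lower

variable {E Ω : Type*} {c : E → ℝ≥0∞} {α : ℝ≥0 → Ω → E}

/-- The control `α` with its values on `(s, s + h]` replaced by `ξ`. -/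
noncomputable def extendControl (α : ℝ≥0 → Ω → E) (s h : ℝ≥0) (ξ : Ω → E) (u : ℝ≥0) (ω : Ω) : E :=
  open Classical in if u ∈ Set.Ioc s (s + h) then ξ ω else α u ω

theorem extendControl_of_le {s h : ℝ≥0} {ξ : Ω → E} {u : ℝ} (hu : u ∈ Set.Ioc (0 : ℝ) s) (ω : Ω) :
    extendControl α s h ξ u.toNNReal ω = α u.toNNReal ω :=
  if_neg fun h => h.1.not_ge (Real.toNNReal_le_iff_le_coe.2 hu.2)

theorem extendControl_of_mem {s h : ℝ≥0} {ξ : Ω → E} {u : ℝ}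
    (hu : u ∈ Set.Ioc (s : ℝ) (s + h : ℝ≥0)) (ω : Ω) :
    extendControl α s h ξ u.toNNReal ω = ξ ω :=
  if_pos ⟨Real.lt_toNNReal_iff_coe_lt.2 hu.1, Real.toNNReal_le_iff_le_coe.2 hu.2⟩

theorem runningCost_extendControl {s h : ℝ≥0} {ξ : Ω → E} (ω : Ω) :
    runningCost c (extendControl α s h ξ) (s + h) ω = runningCost c α s ω + h * c (ξ ω) := by
  rw [runningCost, ← Set.Ioc_union_Ioc_eq_Ioc (b := (s : ℝ)) s.2 (by simp),
    lintegral_union measurableSet_Ioc (Set.Ioc_disjoint_Ioc_of_le le_rfl)]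
  congr 1
  · exact setLIntegral_congr_fun measurableSet_Ioc fun u hu => by
      simp only [extendControl_of_le hu]
  · rw [setLIntegral_congr_fun (g := fun _ => c (ξ ω)) measurableSet_Ioc fun u hu => by
      simp only [extendControl_of_mem hu]]
    simp [mul_comm]

variable [NormedAddCommGroup E] [MeasurableSpace E] {mΩ : MeasurableSpace Ω} {P : Measure Ω}
  {ℱ : Filtration ℝ≥0 mΩ} {Y : ℝ≥0 → Ω → E} {μ : ℝ≥0 → Measure E} {f g : E → ℝ}

theorem IsControl.extendControl (hα : IsControl P ℱ α) {s h : ℝ≥0} {ξ : Ω → E}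
    (hξ : Measurable[ℱ s] ξ) : IsControl P ℱ (extendControl α s h ξ) where
  measurable := by
    refine Measurable.ite (measurable_fst measurableSet_Ioc) ?_ hα.measurable
    exact (hξ.mono (ℱ.le s) le_rfl).comp measurable_snd
  adapted u := by
    by_cases hu : u ∈ Set.Ioc s (s + h)
    · rw [show LevyControl.extendControl α s h ξ u = ξ from funext fun ω => if_pos hu]
      exact hξ.mono (ℱ.mono hu.1.le) le_rfl
    · rw [show LevyControl.extendControl α s h ξ u = α u from funext fun ω => if_neg hu]
      exact hα.adapted u
  integrable := by
    filter_upwards [hα.integrable] with ω hω t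
    calc ∫⁻ u in Set.Ioc (0 : ℝ) t, ‖LevyControl.extendControl α s h ξ u.toNNReal ω‖ₑ
        ≤ ∫⁻ u in Set.Ioc (0 : ℝ) t, (‖α u.toNNReal ω‖ₑ + ‖ξ ω‖ₑ) := by
          refine lintegral_mono fun u => ?_
          unfold LevyControl.extendControl
          split_ifs
          · exact le_add_self
          · exact le_self_add
      _ = (∫⁻ u in Set.Ioc (0 : ℝ) t, ‖α u.toNNReal ω‖ₑ) + ‖ξ ω‖ₑ * t := by
          rw [lintegral_add_right _ measurable_const]; simp
      _ < ⊤ := ENNReal.add_lt_top.2 ⟨hω t, ENNReal.mul_lt_top (by simp) (by simp)⟩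

variable [NormedSpace ℝ E] [BorelSpace E] [SecondCountableTopology E]

/-- Nearly optimal displacements in the Hopf-Lax formula can be chosen measurably with countably
many values. -/
theorem exists_measurable_selector (h0 : c 0 = 0) {h : ℝ≥0} (hh : h ≠ 0) {G : E → ℝ}
    (hG : IsUCb G) {ε : ℝ} (hε : 0 < ε) :
    ∃ (N : E → ℕ) (b : ℕ → E), Measurable N ∧ (∀ n, c (b n) ≠ ⊤) ∧
      ∀ x, hopfLax c h G x - ε ≤ G (x + h • b (N x)) - h * (c (b (N x))).toReal := by
  classical
  -- One third of ε each for moving G, for moving its Hopf-Lax transform, and for near-optimality at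
  -- a dense point.
  obtain ⟨δ₁, hδ₁, H₁⟩ := Metric.uniformContinuous_iff.1 hG.1 (ε / 3) (by positivity)
  obtain ⟨δ₂, hδ₂, H₂⟩ :=
    Metric.uniformContinuous_iff.1 (hG.hopfLax (t := h) h0).1 (ε / 3) (by positivity)
  let z : ℕ → E := TopologicalSpace.denseSeq E
  have hb : ∀ n, ∃ b, c b ≠ ⊤ ∧ hopfLax c h G (z n) - ε / 3 < G (z n + h • b) - h * (c b).toReal :=
    fun n => exists_lt_of_lt_hopfLax hh h0 hG.2 (by linarith)
  choose b hbc hb using hb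
  have hN : ∀ x, ∃ n, dist x (z n) < min δ₁ δ₂ := fun x => by
    obtain ⟨y, hy, n, rfl⟩ := Metric.dense_iff.1 (TopologicalSpace.denseRange_denseSeq E) x
      (min δ₁ δ₂) (lt_min hδ₁ hδ₂)
    exact ⟨n, by rwa [dist_comm]⟩
  refine ⟨fun x => Nat.find (hN x), b, ?_, hbc, fun x => ?_⟩
  · exact measurable_find hN fun n => measurableSet_lt (measurable_id.dist measurable_const)
      measurable_const
  · have hx := Nat.find_spec (hN x)
    set n := Nat.find (hN x)
    have h1 := H₁ (a := x + h • b n) (b := z n + h • b n)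
      (by rw [dist_add_right]; exact hx.trans_le (min_le_left _ _))
    have h2 := H₂ (hx.trans_le (min_le_right _ _))
    rw [Real.dist_eq, abs_lt] at h1 h2
    linarith [hb n, h1.1, h2.2]

variable [CompleteSpace E]

theorem IsControl.controlled_extendControl (hα : IsControl P ℱ α) {s h : ℝ≥0}
    {ξ : Ω → E} (hξ : Measurable[ℱ s] ξ) (x : E) :
    ∀ᵐ ω ∂P, controlled Y (LevyControl.extendControl α s h ξ) x (s + h) ω =
      controlled Y α x s ω + h • ξ ω + (Y (s + h) ω - Y s ω) := by
  filter_upwards [(hα.extendControl hξ (h := h)).integrableOn] with ω hi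
  rw [controlled, ← Set.Ioc_union_Ioc_eq_Ioc (b := (s : ℝ)) s.2 (by simp),
    setIntegral_union (Set.Ioc_disjoint_Ioc_of_le le_rfl) measurableSet_Ioc (hi s)
      ((hi _).mono_set (Set.Ioc_subset_Ioc_left s.2)),
    setIntegral_congr_fun measurableSet_Ioc fun u hu => extendControl_of_le hu ω,
    setIntegral_congr_fun (g := fun _ => ξ ω) measurableSet_Ioc fun u hu =>
      extendControl_of_mem hu ω, controlled]
  simp only [integral_const, MeasurableSet.univ, measureReal_restrict_apply, Set.univ_inter,
    Real.volume_real_Ioc, NNReal.coe_add, add_sub_cancel_left, NNReal.smul_def]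
  rw [max_eq_left h.coe_nonneg]
  abel

variable [IsProbabilityMeasure P]

/-- On (s, s + h] the control is a nearly optimal velocity for Φ_h applied to μ_h g, chosen from the
state at s; the later increment turns g into μ_h g. -/
theorem IsControl.exists_extension (hα : IsControl P ℱ α) (hY : IsLevyProcess P ℱ Y)
    (h0 : c 0 = 0) {h : ℝ≥0} (hh : h ≠ 0) (hμ : HasLaw (Y h) (μ h) P) (hg : IsUCb g) (x : E)
    (s : ℝ≥0) {ε : ℝ} (hε : 0 < ε) :
    ∃ (α' : ℝ≥0 → Ω → E) (K : ℝ≥0∞), IsControl P ℱ α' ∧ K ≠ ⊤ ∧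
      ∫⁻ ω, runningCost c α' (s + h) ω ∂P = ∫⁻ ω, runningCost c α s ω ∂P + K ∧
      ∫ ω, opJ c μ h g (controlled Y α x s ω) ∂P ≤
        ∫ ω, g (controlled Y α' x (s + h) ω) ∂P - K.toReal + ε := by
  have : IsProbabilityMeasure (μ h) := hμ.map_eq ▸ Measure.isProbabilityMeasure_map hμ.aemeasurable
  -- The filtration need not be complete, so the choice uses an ℱ s-measurable version of the state.
  obtain ⟨X, hX, hXc⟩ := hα.aestronglyMeasurable_controlled hY x s
  have hXm : Measurable X := (hX.mono (ℱ.le s)).measurable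
  have hG : IsUCb (transition (μ h) g) := hg.transition
  have hΦ : IsUCb (hopfLax c h (transition (μ h) g)) := hG.hopfLax h0
  obtain ⟨N, b, hN, hbc, hb⟩ := exists_measurable_selector h0 hh hG hε
  have hξ : Measurable[ℱ s] fun ω => b (N (X ω)) :=
    (measurable_from_nat (f := b)).comp (hN.comp hX.measurable)
  set κ : Ω → ℝ≥0∞ := fun ω => h * c (b (N (X ω))) with hκ
  have hκm : Measurable κ :=
    (measurable_from_nat (f := fun n => (h : ℝ≥0∞) * c (b n))).comp (hN.comp hXm)
  have hκfin : ∀ ω, κ ω ≠ ⊤ := fun ω => ENNReal.mul_ne_top ENNReal.coe_ne_top (hbc _)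
  -- Near-optimality, read backwards, bounds the cost by an integrable function.
  have hκb : ∀ ω, (κ ω).toReal ≤
      transition (μ h) g (X ω + h • b (N (X ω))) - hopfLax c h (transition (μ h) g) (X ω) + ε := by
    intro ω
    have := hb (X ω)
    rw [hκ, ENNReal.toReal_mul, ENNReal.coe_toReal]
    linarith
  have hint1 : Integrable (fun ω => transition (μ h) g (X ω + h • b (N (X ω)))) P :=
    hG.integrable_comp (hXm.add ((hξ.mono (ℱ.le s) le_rfl).const_smul h)).aemeasurable
  have hint2 : Integrable (fun ω => hopfLax c h (transition (μ h) g) (X ω)) P :=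
    hΦ.integrable_comp hXm.aemeasurable
  have hint3 := (hint1.sub hint2).add (integrable_const ε)
  have hκi : Integrable (fun ω => (κ ω).toReal) P :=
    hint3.mono' hκm.ennreal_toReal.aestronglyMeasurable (Eventually.of_forall fun ω => by
      rw [Real.norm_of_nonneg ENNReal.toReal_nonneg]; exact hκb ω)
  have hKtop : ∫⁻ ω, κ ω ∂P ≠ ⊤ := by
    have := hκi.2
    rw [hasFiniteIntegral_iff_ofReal (Eventually.of_forall fun ω => ENNReal.toReal_nonneg)] at this
    simpa only [ENNReal.ofReal_toReal (hκfin _)] using this.ne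
  refine ⟨LevyControl.extendControl α s h fun ω => b (N (X ω)), ∫⁻ ω, κ ω ∂P,
    hα.extendControl hξ, hKtop, ?_, ?_⟩
  · simp_rw [runningCost_extendControl]
    -- Only the new cost must be measurable; the past cost may fail to be.
    exact lintegral_add_right _ hκm
  · have h1 : ∫ ω, opJ c μ h g (controlled Y α x s ω) ∂P =
        ∫ ω, hopfLax c h (transition (μ h) g) (X ω) ∂P := by
      rw [opJ_of_ne_zero hh]
      exact integral_congr_ae (hXc.mono fun ω hω => by simp only [hω])
    have h2 : ∫ ω, g (controlled Y (LevyControl.extendControl α s h fun ω => b (N (X ω))) x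
        (s + h) ω) ∂P = ∫ ω, transition (μ h) g (X ω + h • b (N (X ω))) ∂P := by
      rw [← integral_add_eq_integral_transition (ℱ.le s) (X := fun ω => X ω + h • b (N (X ω)))
        (hX.measurable.add (hξ.const_smul h)).stronglyMeasurable.aestronglyMeasurable
        (hY.measurable_increment s (s + h)) (hY.map_increment hμ s) (hY.indep s _ le_self_add) hg]
      refine integral_congr_ae ?_
      filter_upwards [hα.controlled_extendControl (Y := Y) hξ x, hXc] with ω h3 h4
      rw [h3, h4]
    have h5 := integral_mono hκi hint3 hκb
    rw [integral_add' (hint1.sub hint2) (integrable_const ε), integral_sub' hint1 hint2,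
      integral_toReal hκm.aemeasurable (Eventually.of_forall fun ω => (hκfin ω).lt_top)] at h5
    simp only [integral_const, probReal_univ, one_smul] at h5
    rw [h1, h2]
    linarith

theorem exists_control_iterate_opJ_le (hY : IsLevyProcess P ℱ Y) (h0 : c 0 = 0) {h : ℝ≥0}
    (hh : h ≠ 0) (hμ : HasLaw (Y h) (μ h) P) (x : E) (k : ℕ) (hg : IsUCb g) {ε : ℝ}
    (hε : 0 < ε) :
    ∃ α : ℝ≥0 → Ω → E, IsControl P ℱ α ∧ ∫⁻ ω, runningCost c α (k * h) ω ∂P ≠ ⊤ ∧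
      (opJ c μ h)^[k] g x ≤ ∫ ω, g (controlled Y α x (k * h) ω) ∂P -
        (∫⁻ ω, runningCost c α (k * h) ω ∂P).toReal + ε := by
  have : IsProbabilityMeasure (μ h) := hμ.map_eq ▸ Measure.isProbabilityMeasure_map hμ.aemeasurable
  induction k generalizing g ε with
  | zero =>
    refine ⟨fun _ _ => 0, ⟨measurable_const, fun _ => measurable_const, by simp⟩, ?_, ?_⟩
    · simp [runningCost]
    · have : ∫ ω, g (controlled Y (fun _ _ => 0) x 0 ω) ∂P = ∫ _, g x ∂P := by
        refine integral_congr_ae ?_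
        filter_upwards [hY.zero] with ω hω
        simp [controlled, hω]
      simp [runningCost, this, hε.le]
  | succ k ih =>
    obtain ⟨α, hα, hfin, hle⟩ := ih (hg.opJ (μ := μ) h0 hh) (half_pos hε)
    obtain ⟨α', K, hα', hK, hcost, hle'⟩ :=
      hα.exists_extension hY h0 hh hμ hg x (k * h) (half_pos hε)
    have hk : ((k + 1 : ℕ) : ℝ≥0) * h = k * h + h := by push_cast; ring
    rw [hk]
    refine ⟨α', hα', hcost ▸ ENNReal.add_ne_top.2 ⟨hfin, hK⟩, ?_⟩
    rw [hcost, ENNReal.toReal_add hfin hK, Function.iterate_succ_apply]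
    linarith

theorem iterate_opJ_le_value (hY : IsLevyProcess P ℱ Y) (h0 : c 0 = 0) {h : ℝ≥0}
    (hh : h ≠ 0) (hμ : HasLaw (Y h) (μ h) P) (hf : IsUCb f) (x : E) (k : ℕ) :
    (((opJ c μ h)^[k] f x : ℝ) : EReal) ≤ value P ℱ Y c (k * h) f x := by
  by_contra! hlt
  obtain ⟨r, hr1, hr2⟩ := EReal.lt_iff_exists_real_btwn.1 hlt
  rw [EReal.coe_lt_coe_iff] at hr2
  obtain ⟨α, hα, hfin, hle⟩ :=
    exists_control_iterate_opJ_le hY h0 hh hμ x k hf (sub_pos.2 hr2)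
  refine hr1.not_ge (le_iSup₂_of_le α hα ?_)
  rw [coe_sub_coe_ennreal _ hfin, EReal.coe_le_coe_iff]
  linarith

end Lower

/-! ### Combination of the bounds -/

section Main

variable {E : Type*} [NormedAddCommGroup E] [NormedSpace ℝ E] [MeasurableSpace E] [BorelSpace E]
  {c : E → ℝ≥0∞} {Ω : Type*} {mΩ : MeasurableSpace Ω} {P : Measure Ω} [IsProbabilityMeasure P]
  {ℱ : Filtration ℝ≥0 mΩ} {Y : ℝ≥0 → Ω → E} {μ : ℝ≥0 → Measure E} {f : E → ℝ}

theorem value_zero (hY : IsLevyProcess P ℱ Y) (x : E) : value P ℱ Y c 0 f x = f x := by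
  have h : ∀ α : ℝ≥0 → Ω → E, (((∫ ω, f (controlled Y α x 0 ω) ∂P : ℝ) : EReal) -
      ((∫⁻ ω, runningCost c α 0 ω ∂P : ℝ≥0∞) : EReal)) = f x := fun α => by
    have : ∫ ω, f (controlled Y α x 0 ω) ∂P = ∫ _, f x ∂P := by
      refine integral_congr_ae ?_
      filter_upwards [hY.zero] with ω hω
      simp [controlled, hω]
    simp [runningCost, this]
  rw [value]
  simp_rw [h]
  exact le_antisymm (iSup₂_le fun _ _ => le_rfl) (le_iSup₂_of_le (fun _ _ => 0)
    ⟨measurable_const, fun _ => measurable_const, by simp⟩ le_rfl)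

theorem iterate_opJ_le_value_le_iterate_opI [CompleteSpace E] [SecondCountableTopology E]
    (hc : IsCost c) (hY : IsLevyProcess P ℱ Y) (hμ : ∀ t, 0 < t → HasLaw (Y t) (μ t) P)
    (hf : IsUCb f) (t : ℝ≥0) {n : ℕ} (hn : 1 ≤ n) (x : E) :
    (((opJ c μ (t / n))^[n] f x : ℝ) : EReal) ≤ value P ℱ Y c t f x ∧
      value P ℱ Y c t f x ≤ (((opI c μ (t / n))^[n] f x : ℝ) : EReal) := by
  rcases eq_or_ne t 0 with rfl | ht
  · rw [zero_div, iterate_opI_zero, iterate_opJ_zero, value_zero hY]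
    exact ⟨le_rfl, le_rfl⟩
  · have hn' : (n : ℝ≥0) ≠ 0 := by exact_mod_cast (by lia : n ≠ 0)
    have hh : t / n ≠ 0 := div_ne_zero ht hn'
    have hlaw := hμ _ (pos_iff_ne_zero.2 hh)
    have h1 := iterate_opJ_le_value hY hc.zero hh hlaw hf x n
    have h2 := value_le_iterate_opI hY hc hh hlaw hf x n
    rw [mul_div_cancel₀ _ hn'] at h1 h2
    exact ⟨h1, h2⟩

theorem iterate_opI_le_iterate_opJ_add_max (hc : IsCost c)
    (hμ : ∀ t, 0 < t → HasLaw (Y t) (μ t) P) (hf : IsUCb f) {b K ε : ℝ} (hε : 0 ≤ ε)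
    (hK : ∀ a, c a ≠ ⊤ → b * ‖a‖ - (c a).toReal ≤ K)
    (h : ∀ x a, f (x + a) - f x ≤ max ε (b * ‖a‖)) (t : ℝ≥0) {n : ℕ} (hn : 1 ≤ n) (x : E) :
    (opI c μ (t / n))^[n] f x ≤ (opJ c μ (t / n))^[n] f x + max ε (t / n * K) := by
  rcases eq_or_ne t 0 with rfl | ht
  · rw [zero_div, iterate_opI_zero, iterate_opJ_zero]
    exact le_add_of_nonneg_right (hε.trans (le_max_left _ _))
  · have hn' : (n : ℝ≥0) ≠ 0 := by exact_mod_cast (by lia : n ≠ 0)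
    have hh : t / n ≠ 0 := div_ne_zero ht hn'
    have hlaw := hμ _ (pos_iff_ne_zero.2 hh)
    have : IsProbabilityMeasure (μ (t / n)) :=
      hlaw.map_eq ▸ Measure.isProbabilityMeasure_map hlaw.aemeasurable
    refine iterate_opI_le_iterate_opJ_add hc.zero hh hf (fun x => ?_) hn x
    simpa using hopfLax_le_add_max hc.zero hh hf hK h x

end Main

end LevyControl

theorem mainTheorem1 {E : Type*} [NormedAddCommGroup E] [NormedSpace ℝ E] [CompleteSpace E]
    [TopologicalSpace.SeparableSpace E] [MeasurableSpace E] [BorelSpace E]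
    (c : E → ℝ≥0∞) (hc : LevyControl.IsCost c)
    {Ω : Type*} {mΩ : MeasurableSpace Ω} (P : Measure Ω) [IsProbabilityMeasure P]
    (ℱ : Filtration ℝ≥0 mΩ) (Y : ℝ≥0 → Ω → E) (hY : LevyControl.IsLevyProcess P ℱ Y)
    (μ : ℝ≥0 → Measure E) (hμ : ∀ t, 0 < t → HasLaw (Y t) (μ t) P)
    (t : ℝ≥0) (f : E → ℝ) (hf : LevyControl.IsUCb f) :
    -- (a), the bounds from below and above
    (∀ n : ℕ, 1 ≤ n → ∀ x : E,
      (((LevyControl.opJ c μ (t / n))^[n] f x : ℝ) : EReal) ≤ LevyControl.value P ℱ Y c t f x ∧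
      LevyControl.value P ℱ Y c t f x ≤ (((LevyControl.opI c μ (t / n))^[n] f x : ℝ) : EReal)) ∧
    -- (a), the guarantee
    (∀ ε : ℝ, 0 < ε → ∀ n : ℕ, 1 ≤ n →
      (((t : ℝ) / ε : ℝ) : EReal) *
          LevyControl.conj c
            (LevyControl.oscillation f / LevyControl.invModulus f ε).toReal ≤ ((n : ℝ) : EReal) →
      ∀ x : E, |(LevyControl.opI c μ (t / n))^[n] f x - (LevyControl.opJ c μ (t / n))^[n] f x|
        ≤ ε) ∧
    -- (a), the value function as supremum and infimum
    (∀ x : E,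
      IsLUB ((fun n : ℕ => (((LevyControl.opJ c μ (t / n))^[n] f x : ℝ) : EReal)) '' Set.Ici 1)
        (LevyControl.value P ℱ Y c t f x) ∧
      IsGLB ((fun n : ℕ => (((LevyControl.opI c μ (t / n))^[n] f x : ℝ) : EReal)) '' Set.Ici 1)
        (LevyControl.value P ℱ Y c t f x)) ∧
    -- (b), the rate for Lipschitz functions
    (LevyControl.lipSeminorm f < ⊤ → ∀ n : ℕ, 1 ≤ n → ∀ x : E,
      ((|(LevyControl.opI c μ (t / n))^[n] f x - (LevyControl.opJ c μ (t / n))^[n] f x| : ℝ) :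
          EReal)
        ≤ (((t : ℝ) / n : ℝ) : EReal) *
          LevyControl.conj c (LevyControl.lipSeminorm f).toReal) := by
  have : SecondCountableTopology E := UniformSpace.secondCountable_of_separable E
  have hbd := fun (n : ℕ) (hn : 1 ≤ n) (x : E) =>
    LevyControl.iterate_opJ_le_value_le_iterate_opI hc hY hμ hf t hn x
  have habs : ∀ (n : ℕ) (x : E), 1 ≤ n → ∀ r : ℝ, (LevyControl.opI c μ (t / n))^[n] f x ≤
      (LevyControl.opJ c μ (t / n))^[n] f x + r →
      |(LevyControl.opI c μ (t / n))^[n] f x - (LevyControl.opJ c μ (t / n))^[n] f x| ≤ r :=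
    fun n x hn r hr => by
      have h := EReal.coe_le_coe_iff.1 ((hbd n hn x).1.trans (hbd n hn x).2)
      rw [abs_of_nonneg (sub_nonneg.2 h)]
      linarith
  have hguar : ∀ ε : ℝ, 0 < ε → ∀ n : ℕ, 1 ≤ n →
      (((t : ℝ) / ε : ℝ) : EReal) * LevyControl.conj c
        (LevyControl.oscillation f / LevyControl.invModulus f ε).toReal ≤ ((n : ℝ) : EReal) →
      ∀ x : E, (LevyControl.opI c μ (t / n))^[n] f x ≤
        (LevyControl.opJ c μ (t / n))^[n] f x + ε := by
    intro ε hε n hn hle x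
    obtain ⟨K, -, hK, hKc⟩ := hc.sub_le_conj (ENNReal.toReal_nonneg
      (a := LevyControl.oscillation f / LevyControl.invModulus f ε))
    rw [hK, ← EReal.coe_mul, EReal.coe_le_coe_iff] at hle
    have hn0 : (0 : ℝ) < n := by exact_mod_cast hn
    -- The condition n ≥ (t/ε)K says exactly that (t/n)K ≤ ε.
    have hmax : max ε (t / n * K) = ε := by
      refine max_eq_left ?_
      rw [div_mul_eq_mul_div, div_le_iff₀ hε] at hle
      rw [div_mul_eq_mul_div, div_le_iff₀ hn0]
      linarith
    have h := LevyControl.iterate_opI_le_iterate_opJ_add_max hc hμ hf hε.le hKc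
      (hf.sub_le_max hε) t hn x
    rwa [hmax] at h
  have hex : ∀ ε : ℝ, 0 < ε → ∃ n : ℕ, 1 ≤ n ∧ ∀ x : E,
      (LevyControl.opI c μ (t / n))^[n] f x ≤ (LevyControl.opJ c μ (t / n))^[n] f x + ε := by
    intro ε hε
    obtain ⟨K, -, hK, -⟩ := hc.sub_le_conj (ENNReal.toReal_nonneg
      (a := LevyControl.oscillation f / LevyControl.invModulus f ε))
    obtain ⟨n, hn⟩ := exists_nat_ge (t / ε * K)
    -- The natural number found may be 0, so its successor is taken.
    refine ⟨n + 1, by lia, hguar ε hε _ (by lia) ?_⟩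
    rw [hK, ← EReal.coe_mul, EReal.coe_le_coe_iff]
    push_cast
    linarith
  refine ⟨hbd, fun ε hε n hn hle x => habs n x hn ε (hguar ε hε n hn hle x), fun x => ⟨⟨?_, ?_⟩,
    ⟨?_, ?_⟩⟩, fun hL n hn x => ?_⟩
  · rintro _ ⟨n, hn, rfl⟩
    exact (hbd n hn x).1
  · intro u hu
    by_contra! hlt
    -- With u < r < q < V and a gap below q - r, the bounds J^n f ≤ u < r and q < V ≤ I^n f are
    -- incompatible. The infimum is treated symmetrically.
    obtain ⟨r, hr1, hr2⟩ := EReal.lt_iff_exists_real_btwn.1 hlt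
    obtain ⟨q, hq1, hq2⟩ := EReal.lt_iff_exists_real_btwn.1 hr2
    obtain ⟨n, hn, hnx⟩ := hex (q - r) (sub_pos.2 (EReal.coe_lt_coe_iff.1 hq1))
    have h1 := EReal.coe_lt_coe_iff.1 (hq2.trans_le (hbd n hn x).2)
    have h2 := EReal.coe_lt_coe_iff.1 ((hu ⟨n, hn, rfl⟩).trans_lt hr1)
    linarith [hnx x]
  · rintro _ ⟨n, hn, rfl⟩
    exact (hbd n hn x).2
  · intro u hu
    by_contra! hlt
    obtain ⟨r, hr1, hr2⟩ := EReal.lt_iff_exists_real_btwn.1 hlt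
    obtain ⟨q, hq1, hq2⟩ := EReal.lt_iff_exists_real_btwn.1 hr2
    obtain ⟨n, hn, hnx⟩ := hex (q - r) (sub_pos.2 (EReal.coe_lt_coe_iff.1 hq1))
    have h1 := EReal.coe_lt_coe_iff.1 ((hbd n hn x).1.trans_lt hr1)
    have h2 := EReal.coe_lt_coe_iff.1 (hq2.trans_le (hu ⟨n, hn, rfl⟩))
    linarith [hnx x]
  · obtain ⟨K, hK0, hK, hKc⟩ := hc.sub_le_conj (ENNReal.toReal_nonneg
      (a := LevyControl.lipSeminorm f))
    rw [hK, ← EReal.coe_mul, EReal.coe_le_coe_iff]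
    refine habs n x hn _ ?_
    -- With ε = 0 the maximum reduces to its linear term.
    have h := LevyControl.iterate_opI_le_iterate_opJ_add_max hc hμ hf le_rfl hKc
      (fun x a => (LevyControl.sub_le_lipSeminorm_mul hL x a).trans (le_max_right _ _)) t hn x
    rwa [max_eq_right (by positivity)] at h
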